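/- Theorem B. Let $X$ be a locally 1-connected metric space, and let $A_1,\dots,A_n\subseteq X$ be pairwise disjoint subspaces, each of them connected, locally path connected and compact. Let $X/(A_1,\dots,A_n)$ be the quotient space obtained from $X$ by identifying each of the sets $A_i$ to a point, with the quotient topology, and let $p:X\to X/(A_1,\dots,A_n)$ be the quotient map. Then for every $a\in\bigcup_{i=1}^n A_i$, with $*=p(a)$, the induced continuous homomorphism $$p_*:\pi_1^{qtop}(X,a)\to\pi_1^{qtop}(X/(A_1,\dots,A_n),*),\qquad p_*[\gamma]=[p\circ\gamma],$$ is an epimorphism, i.e. it is surjective. Here a space is locally 1-connected if it is locally path connected and locally simply connected; the latter means that every open neighbourhood $U$ of every point $x$ contains an open neighbourhood $V$ of $x$ such that every loop in $V$ is null-homotopic in $U$ (relative to its end points). The group $\pi_1^{qtop}(Y,y)$ is the fundamental group $\pi_1(Y,y)$ with the quotient topology with respect to the canonical map $\Omega(Y,y)\to\pi_1(Y,y)$, $\gamma\mapsto[\gamma]$, where the loop space $\Omega(Y,y)$ carries the compact-open topology. -/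

import Mathlib

open Topology unitInterval

/-- `V` is simply connected in `U`: every loop in `V`, at any base point, contracts to a
constant loop by a homotopy relative to the end points which stays in `U`. -/
def SimplyConnectedIn {X : Type*} [TopologicalSpace X] (V U : Set X) : Prop :=
  ∀ (y : X) (γ : Path y y), (∀ t, γ t ∈ V) →
    ∃ F : Path.Homotopy γ (Path.refl y), ∀ p : I × I, F p ∈ U

/-- A space is locally simply connected if every open neighbourhood `U` of every point `x`
contains an open neighbourhood `V` of `x` which is simply connected in `U`. -/
def LocallySimplyConnected (X : Type*) [TopologicalSpace X] : Prop :=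
  ∀ (x : X) (U : Set X), IsOpen U → x ∈ U →
    ∃ V : Set X, IsOpen V ∧ x ∈ V ∧ V ⊆ U ∧ SimplyConnectedIn V U

/-- A space is locally 1-connected if it is locally path connected and locally simply
connected. -/
structure LocallyOneConnected (X : Type*) [TopologicalSpace X] : Prop where
  locallyPathConnected : LocallyPathConnectedSpace X
  locallySimplyConnected : LocallySimplyConnected X

/-- The quotient of `X` by the equivalence relation generated by identifying, for each `i`, any
two points of `A i`. -/
def Collapse {X ι : Type*} (A : ι → Set X) : Type _ :=
  Quot (fun x y : X => ∃ i, x ∈ A i ∧ y ∈ A i)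

/-- `Collapse A` carries the quotient topology. -/
instance Collapse.instTopologicalSpace {X ι : Type*} [TopologicalSpace X] (A : ι → Set X) :
    TopologicalSpace (Collapse A) :=
  inferInstanceAs (TopologicalSpace (Quot (fun x y : X => ∃ i, x ∈ A i ∧ y ∈ A i)))

/-- The quotient map `X → X/(A₁, …, Aₙ)`. -/
def Collapse.mk {X ι : Type*} [TopologicalSpace X] (A : ι → Set X) : C(X, Collapse A) where
  toFun := Quot.mk _
  continuous_toFun := continuous_quot_mk

/-- The underlying group of the quasitopological fundamental group is the fundamental group. -/
def QTopFundamentalGroup (X : Type*) [TopologicalSpace X] (x : X) : Type _ :=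
  FundamentalGroup X x

namespace QTopFundamentalGroup

noncomputable instance instGroup {X : Type*} [TopologicalSpace X] (x : X) :
    Group (QTopFundamentalGroup X x) :=
  inferInstanceAs (Group (FundamentalGroup X x))

/-- The canonical map from the loop space to the fundamental group. -/
def mk {X : Type*} [TopologicalSpace X] {x : X} (γ : Path x x) : QTopFundamentalGroup X x :=
  FundamentalGroup.fromPath (Path.Homotopic.Quotient.mk γ)

/-- The quotient topology with respect to the canonical map from the loop space, the latter with
the compact-open topology. -/
instance instTopologicalSpace {X : Type*} [TopologicalSpace X] (x : X) :
    TopologicalSpace (QTopFundamentalGroup X x) :=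
  TopologicalSpace.coinduced (mk : Path x x → QTopFundamentalGroup X x) inferInstance

theorem continuous_mk {X : Type*} [TopologicalSpace X] (x : X) :
    Continuous (mk : Path x x → QTopFundamentalGroup X x) :=
  continuous_coinduced_rng

/-- The continuous homomorphism `[γ] ↦ [f ∘ γ]` induced by a continuous map `f`. -/
noncomputable def map {X Y : Type*} [TopologicalSpace X] [TopologicalSpace Y] (f : C(X, Y))
    (x : X) : QTopFundamentalGroup X x →ₜ* QTopFundamentalGroup Y (f x) where
  toMonoidHom := (FundamentalGroup.map f x : FundamentalGroup X x →* FundamentalGroup Y (f x))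
  continuous_toFun := by
    refine continuous_coinduced_dom.2 ?_
    have h : Continuous (fun γ : Path x x => γ.map f.continuous) :=
      Path.continuous_uncurry_iff.1 (f.continuous.comp continuous_eval)
    exact (continuous_mk (f x)).comp h

theorem map_mk {X Y : Type*} [TopologicalSpace X] [TopologicalSpace Y] (f : C(X, Y)) {x : X}
    (γ : Path x x) : map f x (mk γ) = mk (γ.map f.continuous) :=
  rfl

end QTopFundamentalGroup

/-! A path in the quotient need not lift: near a collapsed point it may leave and return infinitely
often, and its excursions, lifted to `X`, need not converge at their ends. By a Lebesgue number
argument and concatenation (`LiftsUpToHomotopy.of_locally`) it suffices to lift, up to homotopy,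
paths `β` that stay in small open sets. Away from the collapsed points the quotient map is a
homeomorphism and `β` itself lifts.

Near the image `y` of `A i`, let `O` be the open set of times with `β ≠ y`. There `β` lifts to a map
`b` whose distance to `A i` tends to `0` at the boundary of `O`. By `exists_homotopy_into`, `b` can
be pushed into `A i` by a homotopy with the same boundary behaviour. Its image, extended by the
constant `y`, is a continuous square contracting `β` to `y`, and the two vertical sides lift to
paths ending in `A i`. Joining these ends inside the path connected set `A i` gives a path whose
image is homotopic to `β`.

The push uses a Whitney decomposition of `O` into intervals on which `b` moves at most its distance
from `A i`. Over each interval, `b`, two short paths to `A i` and a short path in `A i` bound a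
square, filled by local simple connectivity. The paths to `A i` depend only on their starting
points, so neighbouring squares fit together. Paths and fillings are chosen once but must be small
at every scale; `exists_near_optimal` achieves this by choosing each within a factor `2` of the best
size. -/

/-- If the attainable sizes are bounded below by a positive number, some object is optimal up to
a factor `2`. -/
lemma exists_near_optimal {β : Type*} (Q : β → ℝ → Prop) {m : ℝ} (hm : 0 < m)
    (hQ : ∀ c r, Q c r → m ≤ r) (hne : ∃ c r, Q c r) :
    ∃ c, (∃ r, Q c r) ∧ ∀ ε, (∃ c', Q c' (ε / 2)) → ∃ r ≤ ε, Q c r := by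
  set S : Set ℝ := {r | ∃ c, Q c r}
  have hbdd : BddBelow S := ⟨m, fun r ⟨c, hc⟩ => hQ c r hc⟩
  have hS : S.Nonempty := by
    obtain ⟨c, r, h⟩ := hne
    exact ⟨r, c, h⟩
  have hpos : m ≤ sInf S := le_csInf hS fun r ⟨c, hc⟩ => hQ c r hc
  obtain ⟨r, ⟨c, hc⟩, hr⟩ := exists_lt_of_csInf_lt hS (show sInf S < 2 * sInf S by linarith)
  refine ⟨c, ⟨r, hc⟩, fun ε hε => ⟨r, ?_, hc⟩⟩
  have := csInf_le hbdd (show ε / 2 ∈ S from hε)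
  linarith

/-! ### Uniform local connectivity near compact sets -/

/-- Near a compact subset of a locally path connected metric space, close points are joined by
uniformly small paths. -/
lemma IsCompact.exists_joinedIn_ball {Z : Type*} [PseudoMetricSpace Z]
    [LocallyPathConnectedSpace Z] {K : Set Z} (hK : IsCompact K) {ε : ℝ} (hε : 0 < ε) :
    ∃ δ > 0, ∀ a ∈ K, ∀ z, dist z a < δ → JoinedIn (Metric.ball a ε) a z := by
  obtain ⟨δ, hδ, h⟩ := lebesgue_number_lemma_of_metric (s := K)
    (c := fun z : Z => pathComponentIn (Metric.ball z (ε / 2)) z) hK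
    (fun z => Metric.isOpen_ball.pathComponentIn z)
    (fun z _ => Set.mem_iUnion.2 ⟨z, mem_pathComponentIn_self (Metric.mem_ball_self (by linarith))⟩)
  refine ⟨δ, hδ, fun a ha z hz => ?_⟩
  obtain ⟨w, hw⟩ := h a ha
  have h1 : JoinedIn (Metric.ball w (ε / 2)) w a := hw (Metric.mem_ball_self hδ)
  have h2 : JoinedIn (Metric.ball w (ε / 2)) w z := hw hz
  refine (h1.symm.trans h2).mono (Metric.ball_subset_ball' ?_)
  have := h1.target_mem
  rw [Metric.mem_ball, dist_comm] at this
  linarith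

lemma LocallySimplyConnected.exists_ball {X : Type*} [PseudoMetricSpace X]
    (h : LocallySimplyConnected X) {K : Set X} (hK : IsCompact K) {ε : ℝ} (hε : 0 < ε) :
    ∃ δ > 0, δ ≤ ε ∧ ∀ a ∈ K, SimplyConnectedIn (Metric.ball a δ) (Metric.ball a ε) := by
  choose V hVo hxV hVU hV using fun x : X =>
    h x (Metric.ball x (ε / 2)) Metric.isOpen_ball (Metric.mem_ball_self (by linarith))
  obtain ⟨δ, hδ, h⟩ := lebesgue_number_lemma_of_metric (s := K) (c := V) hK hVo
    (fun z _ => Set.mem_iUnion.2 ⟨z, hxV z⟩)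
  refine ⟨min δ ε, lt_min hδ hε, min_le_right _ _, fun a ha y γ hγ => ?_⟩
  obtain ⟨w, hw⟩ := h a ha
  obtain ⟨F, hF⟩ := hV w y γ fun t => hw (Metric.ball_subset_ball (min_le_left _ _) (hγ t))
  refine ⟨F, fun p => Metric.ball_subset_ball' ?_ (hF p)⟩
  have := hVU w (hw (Metric.mem_ball_self hδ))
  rw [Metric.mem_ball, dist_comm] at this
  linarith

lemma Path.homotopic_of_trans_symm {X : Type*} [TopologicalSpace X] {x y : X} {p q : Path x y}
    (h : (p.trans q.symm).Homotopic (Path.refl x)) : p.Homotopic q := by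
  rw [← Path.Homotopic.Quotient.eq] at h ⊢
  have h2 := congrArg (fun z => z.trans (Path.Homotopic.Quotient.mk q)) h
  simpa [Path.Homotopic.Quotient.mk_trans, Path.Homotopic.Quotient.trans_assoc,
    Path.Homotopic.Quotient.mk_symm, Path.Homotopic.Quotient.mk_refl] using h2

/-! ### Filling squares -/

/-- If `V` is simply connected in `U`, two paths in `V` with the same ends are homotopic
in `U`. -/
lemma SimplyConnectedIn.exists_homotopy {X : Type*} [TopologicalSpace X] {V U : Set X}
    (h : SimplyConnectedIn V U) (hVU : V ⊆ U) {x y : X} (p q : Path x y) (hp : ∀ t, p t ∈ V)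
    (hq : ∀ t, q t ∈ V) : ∃ F : p.Homotopy q, ∀ z, F z ∈ U := by
  have hx : x ∈ U := by simpa using hVU (hp 0)
  have hy : y ∈ U := by simpa using hVU (hp 1)
  -- Working in the subspace `U` lets the groupoid calculation produce a homotopy that automatically
  -- stays in `U`.
  let p' : Path (⟨x, hx⟩ : U) ⟨y, hy⟩ :=
    { toFun := fun t => ⟨p t, hVU (hp t)⟩, source' := by simp, target' := by simp }
  let q' : Path (⟨x, hx⟩ : U) ⟨y, hy⟩ :=
    { toFun := fun t => ⟨q t, hVU (hq t)⟩, source' := by simp, target' := by simp }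
  have hpq : ∀ t, ((p'.trans q'.symm) t : X) = (p.trans q.symm) t := by
    intro t
    simp only [Path.trans_apply]
    split_ifs <;> rfl
  obtain ⟨F, hF⟩ := h x (p.trans q.symm) (fun t => by
    simp only [Path.trans_apply]
    split_ifs
    · exact hp _
    · exact hq _)
  have h1 : (p'.trans q'.symm).Homotopic (Path.refl _) :=
    ⟨{ toFun := fun z => ⟨F z, hF z⟩
       map_zero_left := fun t => Subtype.ext (by simpa using (hpq t).symm)
       map_one_left := fun t => Subtype.ext (by simp)
       prop' := fun t s hs => Subtype.ext (by
        rcases hs with rfl | rfl <;> simp) }⟩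
  obtain ⟨G⟩ := Path.homotopic_of_trans_symm h1
  exact ⟨G.map ⟨Subtype.val, continuous_subtype_val⟩, fun z => (G z).2⟩

/-- A square with three prescribed sides in `V` and the fourth one in `A`. -/
lemma SimplyConnectedIn.exists_square {X : Type*} [TopologicalSpace X] {V U A : Set X}
    (h : SimplyConnectedIn V U) (hVU : V ⊆ U) {x y a b : X} (ξ : Path x y) (κ : Path x a)
    (τ : Path a b) (κ' : Path y b) (hξ : ∀ t, ξ t ∈ V) (hκ : ∀ t, κ t ∈ V)
    (hκ' : ∀ t, κ' t ∈ V) (hτ : ∀ t, τ t ∈ V) (hτA : ∀ t, τ t ∈ A) :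
    ∃ H : C(I × I, X), (∀ t, H (t, 0) = ξ t) ∧ (∀ s, H (0, s) = ((Path.refl x).trans κ) s) ∧
      (∀ s, H (1, s) = ((Path.refl y).trans κ') s) ∧ (∀ t, H (t, 1) ∈ A) ∧ ∀ z, H z ∈ U := by
  set P : Path x y := κ.trans (τ.trans κ'.symm) with hP
  have hPV : ∀ t, P t ∈ V := by
    intro t
    simp only [hP, Path.trans_apply]
    split_ifs
    · exact hκ _
    · exact hτ _
    · exact hκ' _
  obtain ⟨F, hF⟩ := h.exists_homotopy hVU ξ P hξ hPV
  have hPe : ∀ r, P.extend r ∈ V := fun r => hPV _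
  -- `P` runs through `κ` on `[0, 1/2]`, `τ` on `[1/2, 3/4]` and `κ'` backwards on `[3/4, 1]`. At
  -- time `s`, `G` is `P` restricted to `[s/2, 1 - s/4]`: its ends trace `κ` and `κ'`, and at `s =
  -- 1` only `τ` remains. Preceding `G` by `F`, which fixes the ends, is what puts `Path.refl`
  -- before `κ` and `κ'`.
  let Q : C(I, X) := ⟨fun t => P.extend ((1 - t) * (1 / 2) + t * (3 / 4)), by fun_prop⟩
  let G : ContinuousMap.Homotopy P.toContinuousMap Q :=
    { toFun := fun z => P.extend ((1 - z.2) * (z.1 / 2) + z.2 * (1 - z.1 / 4))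
      continuous_toFun := by fun_prop
      map_zero_left := fun t => by simp
      map_one_left := fun t => by simp only [Q]; norm_num }
  have hG : ∀ s t, G (s, t) = P.extend ((1 - t) * (s / 2) + t * (1 - s / 4)) := fun s t => rfl
  have hG0 : ∀ s, G (s, 0) = κ s := by
    intro s
    have hs : (s : ℝ) / 2 ∈ I := ⟨by linarith [s.2.1], by linarith [s.2.2]⟩
    rw [hG]
    simp only [Set.Icc.coe_zero, sub_zero, one_mul, zero_mul, add_zero]
    rw [Path.extend_apply P hs, hP, Path.trans_apply, dif_pos (by simp; linarith [s.2.2])]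
    congr 1
    ext
    simp
    ring
  have hG1 : ∀ s, G (s, 1) = κ' s := by
    intro s
    have hs : 1 - (s : ℝ) / 4 ∈ I := ⟨by linarith [s.2.2], by linarith [s.2.1]⟩
    rw [hG]
    simp only [Set.Icc.coe_one, sub_self, one_mul, zero_mul, zero_add]
    rw [Path.extend_apply P hs, hP, Path.trans_apply]
    have h1 : ¬ (1 - (s : ℝ) / 4 ≤ 1 / 2) := by linarith [s.2.2]
    rw [dif_neg h1, Path.trans_apply]
    -- At `s = 1` the parameter is the seam `3/4`, which `Path.trans` assigns to `τ` rather than to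
    -- `κ'.symm`.
    by_cases h2 : (s : ℝ) = 1
    · have h3 : s = 1 := Subtype.ext h2
      subst h3
      have h4 : (2 * (1 - ((1 : I) : ℝ) / 4) - 1) ≤ 1 / 2 := by norm_num
      rw [dif_pos h4]
      norm_num
    · have h3 : (s : ℝ) < 1 := lt_of_le_of_ne s.2.2 h2
      have h4 : ¬ (2 * (1 - (s : ℝ) / 4) - 1) ≤ 1 / 2 := by linarith
      rw [dif_neg h4]
      change κ' (unitInterval.symm _) = κ' s
      congr 1
      ext
      simp only [unitInterval.coe_symm_eq]
      ring
  have hside : ∀ t, (∀ s, F (s, t) = F (0, t)) → ∀ z (ρ : Path (ξ t) z), (∀ s, G (s, t) = ρ s) →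
      ∀ s, (F.toHomotopy.trans G) (s, t) = ((Path.refl (ξ t)).trans ρ) s := by
    intro t hFt z ρ hρ s
    rw [ContinuousMap.Homotopy.trans_apply, Path.trans_apply]
    split_ifs
    · exact (hFt _).trans (F.apply_zero t)
    · exact hρ _
  refine ⟨(F.toHomotopy.trans G).toContinuousMap.comp ⟨Prod.swap, continuous_swap⟩, ?_, ?_, ?_,
    ?_, ?_⟩
  · intro t
    exact (F.toHomotopy.trans G).apply_zero t
  · intro s
    have := hside 0 (fun s => by simp) a (κ.cast ξ.source rfl) (fun s => by simp [hG0]) s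
    refine this.trans ?_
    simp only [Path.trans_apply]
    split_ifs <;> simp
  · intro s
    have := hside 1 (fun s => by simp) b (κ'.cast ξ.target rfl) (fun s => by simp [hG1]) s
    refine this.trans ?_
    simp only [Path.trans_apply]
    split_ifs <;> simp
  · intro t
    have h1 : (F.toHomotopy.trans G) (1, t) = Q t := (F.toHomotopy.trans G).apply_one t
    refine (congrArg (· ∈ A) h1).mpr ?_
    have hr : (1 - (t : ℝ)) * (1 / 2) + t * (3 / 4) ∈ I :=
      ⟨by linarith [t.2.1], by linarith [t.2.2]⟩
    change P.extend _ ∈ A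
    rw [Path.extend_apply P hr, hP, Path.trans_apply]
    split_ifs with h2
    · have h3 : (t : ℝ) = 0 := by simp only at h2; linarith [t.2.1]
      have : (⟨2 * ((1 - (t : ℝ)) * (1 / 2) + t * (3 / 4)), by rw [h3]; norm_num⟩ : I) = 1 := by
        ext; simp [h3]
      have h4 : κ ⟨2 * ((1 - (t : ℝ)) * (1 / 2) + t * (3 / 4)), by rw [h3]; norm_num⟩ = a := by
        rw [this]; exact κ.target
      refine (congrArg (· ∈ A) h4).mpr ?_
      simpa using hτA 0
    · rw [Path.trans_apply, dif_pos (by simp only; linarith [t.2.2])]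
      exact hτA _
  · rintro ⟨t, s⟩
    change (F.toHomotopy.trans G) (s, t) ∈ U
    rw [ContinuousMap.Homotopy.trans_apply]
    split_ifs
    · exact hF _
    · exact hVU (hPe _)

/-! ### Whitney decomposition by maximal dyadic intervals -/

/-- The dyadic interval `[j / 2 ^ k, (j + 1) / 2 ^ k]` satisfies `good`, and no larger dyadic
interval of length at most `1` does. -/
def IsMaximalDyadic (good : ℝ → ℝ → Prop) (k : ℕ) (j : ℤ) : Prop :=
  good (j / 2 ^ k) ((j + 1) / 2 ^ k) ∧ ∀ k' < k, ∀ j' : ℤ, (j' : ℝ) / 2 ^ k' ≤ j / 2 ^ k →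
    (j + 1 : ℝ) / 2 ^ k ≤ (j' + 1) / 2 ^ k' → ¬ good (j' / 2 ^ k') ((j' + 1) / 2 ^ k')

lemma dyadic_trichotomy {k k' : ℕ} (hk : k ≤ k') (j j' : ℤ) :
    ((j : ℝ) / 2 ^ k ≤ j' / 2 ^ k' ∧ (j' + 1 : ℝ) / 2 ^ k' ≤ (j + 1) / 2 ^ k) ∨
      (j' + 1 : ℝ) / 2 ^ k' ≤ j / 2 ^ k ∨ (j + 1 : ℝ) / 2 ^ k ≤ j' / 2 ^ k' := by
  obtain ⟨m, rfl⟩ := Nat.exists_eq_add_of_le hk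
  have key : ∀ a b : ℤ, ((a : ℝ) / 2 ^ k ≤ b / 2 ^ (k + m) ↔ a * 2 ^ m ≤ b) ∧
      ((b : ℝ) / 2 ^ (k + m) ≤ a / 2 ^ k ↔ b ≤ a * 2 ^ m) := by
    intro a b
    rw [pow_add]
    constructor
    · rw [div_le_div_iff₀ (by positivity) (by positivity),
        show (a : ℝ) * (2 ^ k * 2 ^ m) = (a * 2 ^ m) * 2 ^ k by ring,
        mul_le_mul_iff_left₀ (by positivity)]
      exact_mod_cast Iff.rfl
    · rw [div_le_div_iff₀ (by positivity) (by positivity),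
        show (a : ℝ) * (2 ^ k * 2 ^ m) = (a * 2 ^ m) * 2 ^ k by ring,
        mul_le_mul_iff_left₀ (by positivity)]
      exact_mod_cast Iff.rfl
  have h1 := (key j j').1
  have h2 := (key (j + 1) (j' + 1)).2
  have h3 := (key j (j' + 1)).2
  have h4 := (key (j + 1) j').1
  push_cast at h1 h2 h3 h4
  rw [h1, h2, h3, h4]
  omega

/-- Dyadic intervals are nested or do not overlap, and a strictly coarser good interval would
contradict maximality of the finer one. -/
lemma IsMaximalDyadic.eq_or {good : ℝ → ℝ → Prop} {k k' : ℕ} {j j' : ℤ}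
    (h : IsMaximalDyadic good k j) (h' : IsMaximalDyadic good k' j') :
    (k = k' ∧ j = j') ∨ (j' + 1 : ℝ) / 2 ^ k' ≤ j / 2 ^ k ∨
      (j + 1 : ℝ) / 2 ^ k ≤ j' / 2 ^ k' := by
  wlog hk : k ≤ k' generalizing k k' j j'
  · rcases this h' h (by omega) with h | h | h
    · exact .inl ⟨h.1.symm, h.2.symm⟩
    · exact .inr (.inr h)
    · exact .inr (.inl h)
  rcases dyadic_trichotomy hk j j' with h1 | h1
  · rcases hk.eq_or_lt with rfl | hlt
    · left
      refine ⟨rfl, ?_⟩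
      have hp : (0 : ℝ) < 2 ^ k := by positivity
      have h2 := (div_le_div_iff_of_pos_right hp).1 h1.1
      have h3 := (div_le_div_iff_of_pos_right hp).1 h1.2
      have h4 : j ≤ j' := by exact_mod_cast h2
      have h5 : j' + 1 ≤ j + 1 := by exact_mod_cast h3
      omega
    · exact absurd h.1 (h'.2 k hlt j h1.1 h1.2)
  · exact .inr h1

/-- At each level exactly one half-open dyadic interval contains `t`, so the least level at which it
is good gives a maximal one. -/
lemma exists_isMaximalDyadic_right {good : ℝ → ℝ → Prop} {t : ℝ}
    (hloc : ∃ η > 0, ∀ u v, t - η < u → u < v → v < t + η → good u v) :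
    ∃ k j, IsMaximalDyadic good k j ∧ (j : ℝ) / 2 ^ k ≤ t ∧ t < (j + 1) / 2 ^ k := by
  classical
  have huniq : ∀ (k : ℕ) (j : ℤ), ((j : ℝ) / 2 ^ k ≤ t ∧ t < (j + 1) / 2 ^ k) ↔
      j = ⌊t * 2 ^ k⌋ := by
    intro k j
    rw [div_le_iff₀ (by positivity), lt_div_iff₀ (by positivity), eq_comm, Int.floor_eq_iff]
  have hex : ∃ k : ℕ, good (⌊t * 2 ^ k⌋ / 2 ^ k) ((⌊t * 2 ^ k⌋ + 1) / 2 ^ k) := by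
    obtain ⟨η, hη, h⟩ := hloc
    obtain ⟨k, hk⟩ := exists_pow_lt_of_lt_one hη (show (1 / 2 : ℝ) < 1 by norm_num)
    refine ⟨k, ?_⟩
    obtain ⟨h1, h2⟩ := (huniq k _).2 rfl
    have h3 : ((⌊t * 2 ^ k⌋ : ℝ) + 1) / 2 ^ k = ⌊t * 2 ^ k⌋ / 2 ^ k + (1 / 2) ^ k := by
      rw [add_div, one_div, one_div, inv_pow]
    have h4 : (0 : ℝ) < (1 / 2) ^ k := by positivity
    rw [h3] at h2 ⊢
    exact h _ _ (by linarith) (by linarith) (by linarith)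
  refine ⟨Nat.find hex, _, ⟨Nat.find_spec hex, fun k' hk' j' h1 h2 hg => ?_⟩, (huniq _ _).2 rfl⟩
  obtain ⟨h3, h4⟩ := (huniq (Nat.find hex) _).2 rfl
  rw [(huniq k' j').1 ⟨h1.trans h3, h4.trans_le h2⟩] at hg
  exact Nat.find_min hex hk' hg

/-- Reflection exchanges the two half-open conventions, so intervals reaching `t` from the left come
from those on the right of `-t`. -/
lemma IsMaximalDyadic.neg {good : ℝ → ℝ → Prop} {k : ℕ} {j : ℤ}
    (h : IsMaximalDyadic (fun u v => good (-v) (-u)) k j) :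
    IsMaximalDyadic good k (-j - 1) := by
  have e : ∀ (k : ℕ) (j : ℤ), ((-j - 1 : ℤ) : ℝ) / 2 ^ k = -((j + 1) / 2 ^ k) ∧
      (((-j - 1 : ℤ) : ℝ) + 1) / 2 ^ k = -(j / 2 ^ k) := by
    intro k j
    push_cast
    constructor <;> ring
  refine ⟨by rw [(e k j).1, (e k j).2]; exact h.1, fun k' hk' j' h1 h2 hg => ?_⟩
  obtain ⟨i, rfl⟩ : ∃ i, j' = -i - 1 := ⟨-j' - 1, by ring⟩
  rw [(e _ _).1, (e _ _).1] at h1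
  rw [(e _ _).2, (e _ _).2] at h2
  rw [(e _ _).1, (e _ _).2] at hg
  exact h.2 k' hk' i (by linarith) (by linarith) hg

lemma exists_isMaximalDyadic_left {good : ℝ → ℝ → Prop} {t : ℝ}
    (hloc : ∃ η > 0, ∀ u v, t - η < u → u < v → v < t + η → good u v) :
    ∃ k j, IsMaximalDyadic good k j ∧ (j : ℝ) / 2 ^ k < t ∧ t ≤ (j + 1) / 2 ^ k := by
  obtain ⟨η, hη, h⟩ := hloc
  obtain ⟨k, j, hm, h1, h2⟩ := exists_isMaximalDyadic_right
    (good := fun u v => good (-v) (-u)) (t := -t)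
    ⟨η, hη, fun u v h1 h2 h3 => h _ _ (by linarith) (by linarith) (by linarith)⟩
  have e : ((-j - 1 : ℤ) : ℝ) / 2 ^ k = -((j + 1) / 2 ^ k) ∧
      (((-j - 1 : ℤ) : ℝ) + 1) / 2 ^ k = -(j / 2 ^ k) := by
    push_cast
    constructor <;> ring
  exact ⟨k, -j - 1, hm.neg, by rw [e.1]; linarith, by rw [e.2]; linarith⟩

/-- Whitney decomposition of an open subset `O` of the line into intervals satisfying a property
which holds for all small intervals around each point of `O`. -/
lemma exists_whitney_decomposition (good : ℝ → ℝ → Prop) (O : Set ℝ)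
    (hloc : ∀ t ∈ O, ∃ η > 0, ∀ u v, t - η < u → u < v → v < t + η → good u v) :
    ∃ W : Set (ℝ × ℝ), (∀ J ∈ W, J.1 < J.2 ∧ good J.1 J.2) ∧
      (∀ J ∈ W, ∀ J' ∈ W, J = J' ∨ J'.2 ≤ J.1 ∨ J.2 ≤ J'.1) ∧
      ∀ t ∈ O, ∃ J ∈ W, ∃ J' ∈ W, t ∈ Set.Icc J.1 J.2 ∧ t ∈ Set.Icc J'.1 J'.2 ∧
        Set.Icc J.1 J.2 ∪ Set.Icc J'.1 J'.2 ∈ 𝓝 t := by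
  refine ⟨{J | ∃ k j, IsMaximalDyadic good k j ∧
    J = ((j : ℝ) / 2 ^ k, (j + 1 : ℝ) / 2 ^ k)}, ?_, ?_, ?_⟩
  · rintro _ ⟨k, j, h, rfl⟩
    exact ⟨(div_lt_div_iff_of_pos_right (by positivity)).2 (by linarith), h.1⟩
  · rintro _ ⟨k, j, h, rfl⟩ _ ⟨k', j', h', rfl⟩
    rcases h.eq_or h' with ⟨rfl, rfl⟩ | h
    · exact .inl rfl
    · exact .inr h
  · intro t ht
    -- One interval on each side of `t` covers a neighbourhood of `t`, which replaces local
    -- finiteness when the pieces are glued.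
    obtain ⟨k, j, h, h1, h2⟩ := exists_isMaximalDyadic_left (hloc t ht)
    obtain ⟨k', j', h', h1', h2'⟩ := exists_isMaximalDyadic_right (hloc t ht)
    refine ⟨_, ⟨k, j, h, rfl⟩, _, ⟨k', j', h', rfl⟩, ⟨h1.le, h2⟩, ⟨h1', h2'.le⟩, ?_⟩
    filter_upwards [Ioo_mem_nhds h1 h2'] with r hr
    rcases le_total r t with hrt | hrt
    · exact .inl ⟨hr.1.le, hrt.trans h2⟩
    · exact .inr ⟨h1'.trans hrt, hr.2.le⟩

/-! ### Pushing maps into a compact set -/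

/-- Points near a compact set `A` are joined to `A` by paths which are the shorter, the closer
the points are to `A`. -/
lemma IsCompact.exists_paths_to {X : Type*} [MetricSpace X] [LocallyPathConnectedSpace X]
    {A : Set X} (hA : IsCompact A) (hne : A.Nonempty) :
    ∃ (e : X → X) (κ : ∀ x, Path x (e x)), ∀ ε > 0, ∃ δ > 0, ∀ x ∉ A, Metric.infDist x A < δ →
      e x ∈ A ∧ ∀ s, κ x s ∈ Metric.ball x ε := by
  have key : ∀ x : X, ∃ (e : X) (κ : Path x e), x ∉ A → ∀ ε : ℝ,
      (∃ (e' : X) (κ' : Path x e'), e' ∈ A ∧ ∀ s, κ' s ∈ Metric.ball x (ε / 2)) →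
      e ∈ A ∧ ∀ s, κ s ∈ Metric.ball x ε := by
    intro x
    by_cases hx : x ∈ A
    · exact ⟨x, Path.refl x, fun h => absurd hx h⟩
    by_cases hex : ∃ c : (Σ e : X, Path x e), ∃ r : ℝ,
        c.1 ∈ A ∧ ∀ s, c.2 s ∈ Metric.ball x r
    -- A path from `x` to `A` has size at least the distance of `x` from `A`, so near-optimal
    -- choices exist.
    · obtain ⟨c, ⟨_, hc, _⟩, h⟩ := exists_near_optimal
        (fun (c : Σ e : X, Path x e) (r : ℝ) => c.1 ∈ A ∧ ∀ s, c.2 s ∈ Metric.ball x r)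
        ((hA.isClosed.notMem_iff_infDist_pos hne).1 hx) (by
          rintro ⟨e', κ'⟩ r ⟨h1, h2⟩
          have h3 := h2 1
          rw [κ'.target, Metric.mem_ball, dist_comm] at h3
          exact (Metric.infDist_le_dist_of_mem h1).trans h3.le) hex
      refine ⟨c.1, c.2, fun _ ε ⟨e', κ', h'⟩ => ⟨hc, fun s => ?_⟩⟩
      obtain ⟨r, hr, h3⟩ := h ε ⟨⟨e', κ'⟩, h'⟩
      exact Metric.ball_subset_ball hr (h3.2 s)
    · exact ⟨x, Path.refl x, fun _ ε ⟨e', κ', h'⟩ => absurd ⟨⟨e', κ'⟩, _, h'⟩ hex⟩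
  choose e κ h using key
  refine ⟨e, κ, fun ε hε => ?_⟩
  obtain ⟨δ, hδ, hδ'⟩ := hA.exists_joinedIn_ball (show 0 < ε / 4 by linarith)
  refine ⟨min δ (ε / 4), lt_min hδ (by linarith), fun x hxA hx => h x hxA ε ?_⟩
  obtain ⟨a, ha, hxa⟩ := (Metric.infDist_lt_iff hne).1 hx
  obtain ⟨γ, hγ⟩ := (hδ' a ha x (hxa.trans_le (min_le_left _ _))).symm
  refine ⟨a, γ, ha, fun s => Metric.ball_subset_ball' ?_ (hγ s)⟩
  have := hxa.trans_le (min_le_right δ (ε / 4))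
  rw [dist_comm] at this
  linarith

/-- `h` is a homotopy, over the interval `[u, v]`, from `b` to a map into `A`, which runs
through prescribed paths at the two ends. -/
structure IsStripFilling {X : Type*} [TopologicalSpace X] (A : Set X) {e : X → X}
    (κ : ∀ x, Path x (e x)) (b : ℝ → X) (u v : ℝ) (h : ℝ × I → X) : Prop where
  continuous : Continuous h
  bottom : ∀ t ∈ Set.Icc u v, h (t, 0) = b t
  left : ∀ s, h (u, s) = ((Path.refl (b u)).trans (κ (b u))) s
  right : ∀ s, h (v, s) = ((Path.refl (b v)).trans (κ (b v))) s
  top : ∀ t, h (t, 1) ∈ A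

/-- If `b` stays close to one `a ∈ A`, the paths `κ` at its ends stay within `η / 2` of `a`, so
their end points are less than `η` apart and a short path in `A` joins them. All four sides lie in a
ball about `a` that is simply connected in the ball of radius `ε`. -/
lemma exists_isStripFilling {X : Type*} [MetricSpace X] (hX : LocallyOneConnected X) {A : Set X}
    (hA : IsCompact A) (hlpc : LocallyPathConnectedSpace A) {e : X → X} (κ : ∀ x, Path x (e x))
    (hκ : ∀ ε > 0, ∃ δ > 0, ∀ x ∉ A, Metric.infDist x A < δ →
      e x ∈ A ∧ ∀ s, κ x s ∈ Metric.ball x ε) {ε : ℝ} (hε : 0 < ε) :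
    ∃ δ > 0, ∀ (b : ℝ → X) (u v : ℝ), u < v → ContinuousOn b (Set.Icc u v) → b u ∉ A → b v ∉ A →
      (∃ a ∈ A, ∀ t ∈ Set.Icc u v, dist (b t) a < δ) →
      ∃ h, IsStripFilling A κ b u v h ∧ ∀ z, Metric.infDist (h z) A < ε := by
  obtain ⟨δ₃, hδ₃, hδ₃ε, hsc⟩ := hX.locallySimplyConnected.exists_ball hA hε
  have : CompactSpace A := isCompact_iff_compactSpace.1 hA
  obtain ⟨δ₂, hδ₂, hj⟩ := (isCompact_univ (X := A)).exists_joinedIn_ball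
    (show 0 < δ₃ / 2 by linarith)
  set η := min δ₂ δ₃ with hηdef
  have hη : 0 < η := lt_min hδ₂ hδ₃
  have hη₂ : η ≤ δ₂ := min_le_left _ _
  have hη₃ : η ≤ δ₃ := min_le_right _ _
  obtain ⟨δ₁, hδ₁, hκ'⟩ := hκ (η / 4) (by linarith)
  refine ⟨min δ₁ (η / 4), lt_min hδ₁ (by linarith), ?_⟩
  rintro b u v huv hb hbu hbv ⟨a, haA, ha⟩
  have hend : ∀ t ∈ Set.Icc u v, b t ∉ A → e (b t) ∈ A ∧ ∀ s, dist (κ (b t) s) a < η / 2 := by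
    intro t ht hbt
    have h1 := ha t ht
    obtain ⟨h2, h3⟩ := hκ' (b t) hbt ((Metric.infDist_le_dist_of_mem haA).trans_lt
      (h1.trans_le (min_le_left _ _)))
    refine ⟨h2, fun s => ?_⟩
    have h4 := h1.trans_le (min_le_right δ₁ (η / 4))
    have h5 := Metric.mem_ball.1 (h3 s)
    linarith [dist_triangle (κ (b t) s) (b t) a]
  obtain ⟨huA, hu⟩ := hend u ⟨le_rfl, huv.le⟩ hbu
  obtain ⟨hvA, hv⟩ := hend v ⟨huv.le, le_rfl⟩ hbv
  have hu1 := hu 1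
  have hv1 := hv 1
  rw [Path.target] at hu1 hv1
  obtain ⟨τ, hτ⟩ := hj ⟨e (b u), huA⟩ trivial ⟨e (b v), hvA⟩ (by
    rw [Subtype.dist_eq]
    have := dist_triangle_right (e (b v)) (e (b u)) a
    simp only
    linarith)
  have hmem : ∀ t : I, u + t * (v - u) ∈ Set.Icc u v := fun t =>
    ⟨by nlinarith [t.2.1], by nlinarith [t.2.2]⟩
  let ξ : Path (b u) (b v) :=
    { toFun := fun t => b (u + t * (v - u))
      continuous_toFun := hb.comp_continuous (by fun_prop) hmem
      source' := by simp
      target' := by simp }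
  obtain ⟨H, hH0, hHl, hHr, hH1, hHU⟩ := (hsc a haA).exists_square (A := A)
    (Metric.ball_subset_ball hδ₃ε) ξ (κ (b u)) (τ.map continuous_subtype_val) (κ (b v))
    (fun t => Metric.mem_ball.2
      (by have := (ha _ (hmem t)).trans_le (min_le_right δ₁ (η / 4)); exact this.trans (by linarith)))
    (fun s => Metric.mem_ball.2 (by linarith [hu s]))
    (fun s => Metric.mem_ball.2 (by linarith [hv s]))
    (fun t => Metric.mem_ball.2 (by
      have h1 := Metric.mem_ball.1 (hτ t)
      rw [Subtype.dist_eq] at h1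
      simp only at h1
      have h2 := dist_triangle ((τ t : A) : X) (e (b u)) a
      simp only [Path.map_coe, Function.comp_apply]
      linarith))
    (fun t => (τ t).2)
  -- Clamping the first coordinate to `[u, v]` makes the filling continuous on the whole strip.
  refine ⟨fun z => H (Set.projIcc 0 1 zero_le_one ((z.1 - u) / (v - u)), z.2), ⟨?_, ?_, ?_, ?_, ?_⟩,
    ?_⟩
  · exact H.continuous.comp ((continuous_projIcc.comp (by fun_prop)).prodMk continuous_snd)
  · intro t ht
    have hpos : 0 < v - u := by linarith
    have h1 : (t - u) / (v - u) ∈ I :=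
      ⟨div_nonneg (by linarith [ht.1]) hpos.le, (div_le_one hpos).2 (by linarith [ht.2])⟩
    simp only
    rw [hH0, Set.projIcc_of_mem _ h1]
    change b (u + (t - u) / (v - u) * (v - u)) = b t
    congr 1
    field_simp
    ring
  · intro s
    simp only [sub_self, zero_div, Set.projIcc_left]
    exact hHl s
  · intro s
    simp only [div_self (show v - u ≠ 0 by linarith), Set.projIcc_right]
    exact hHr s
  · intro t
    exact hH1 _
  · intro z
    exact (Metric.infDist_le_dist_of_mem haA).trans_lt (Metric.mem_ball.1 (hHU _))

/-- A map into the complement of `A`, defined on an open subset `O` of the line and tending to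
`A` at the boundary of `O`, can be pushed into `A` by a homotopy which also tends to `A` at the
boundary of `O`. -/
theorem exists_homotopy_into {X : Type*} [MetricSpace X] (hX : LocallyOneConnected X) {A : Set X}
    (hA : IsCompact A) (hne : A.Nonempty) (hlpc : LocallyPathConnectedSpace A) :
    ∃ δ > 0, ∀ (O : Set ℝ) (b : ℝ → X), IsOpen O → ContinuousOn b O → (∀ t ∈ O, b t ∉ A) →
      (∀ t ∈ O, Metric.infDist (b t) A < δ) →
      (∀ t₀ ∉ O, ∀ ε > 0, ∀ᶠ t in 𝓝 t₀, t ∈ O → Metric.infDist (b t) A < ε) →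
      ∃ H : ℝ × I → X, ContinuousOn H (O ×ˢ Set.univ) ∧ (∀ t ∈ O, H (t, 0) = b t) ∧
        (∀ t ∈ O, H (t, 1) ∈ A) ∧
        ∀ t₀ ∉ O, ∀ ε > 0, ∀ᶠ t in 𝓝 t₀, t ∈ O → ∀ s, Metric.infDist (H (t, s)) A < ε := by
  classical
  have := hX.locallyPathConnected
  obtain ⟨e, κ, hκ⟩ := hA.exists_paths_to hne
  -- As `b` moves at most its distance from `A`, one point of the interval close to `A` forces the
  -- whole image close to a single point of `A`.
  have hfill : ∀ ε > 0, ∃ δ > 0, ∀ (b : ℝ → X) (u v : ℝ), u < v → ContinuousOn b (Set.Icc u v) →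
      (∀ t ∈ Set.Icc u v, b t ∉ A ∧ ∀ t' ∈ Set.Icc u v, dist (b t) (b t') ≤
        Metric.infDist (b t) A) →
      (∃ t ∈ Set.Icc u v, Metric.infDist (b t) A < δ) →
      ∃ h, IsStripFilling A κ b u v h ∧ ∀ z, Metric.infDist (h z) A < ε := by
    intro ε hε
    obtain ⟨δ, hδ, h⟩ := exists_isStripFilling hX hA hlpc κ hκ hε
    refine ⟨δ / 2, by linarith, fun b u v huv hb hgood ⟨t, ht, htδ⟩ =>
      h b u v huv hb (hgood u ⟨le_rfl, huv.le⟩).1 (hgood v ⟨huv.le, le_rfl⟩).1 ?_⟩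
    obtain ⟨a, ha, hta⟩ := (Metric.infDist_lt_iff hne).1 htδ
    refine ⟨a, ha, fun t' ht' => ?_⟩
    have h1 := (hgood t ht).2 t' ht'
    rw [dist_comm] at h1
    linarith [dist_triangle (b t') (b t) a]
  -- The bound `1` is arbitrary; it only guarantees that every Whitney interval has some filling.
  obtain ⟨δ, hδ, hδfill⟩ := hfill 1 one_pos
  refine ⟨δ, hδ, fun O b hO hb hbA hbδ hlim => ?_⟩
  have hpos : ∀ t ∈ O, 0 < Metric.infDist (b t) A := fun t ht =>
    (hA.isClosed.notMem_iff_infDist_pos hne).1 (hbA t ht)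
  obtain ⟨W, hW, hWdisj, hWcov⟩ := exists_whitney_decomposition
    (fun u v => ∀ t ∈ Set.Icc u v, t ∈ O ∧ ∀ t' ∈ Set.Icc u v, dist (b t) (b t') ≤
        Metric.infDist (b t) A) O (by
      intro t₀ ht₀
      have hd := hpos t₀ ht₀
      have h1 : ∀ᶠ t in 𝓝 t₀, t ∈ O ∧ dist (b t) (b t₀) < Metric.infDist (b t₀) A / 4 :=
        Filter.Eventually.and (hO.mem_nhds ht₀)
          ((hb.continuousAt (hO.mem_nhds ht₀)).eventually (Metric.ball_mem_nhds _ (by linarith)))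
      obtain ⟨η, hη, h⟩ := Metric.eventually_nhds_iff.1 h1
      refine ⟨η, hη, fun u v hu huv hv t ht => ?_⟩
      have hnear : ∀ t ∈ Set.Icc u v, dist t t₀ < η := fun t ht => by
        rw [Real.dist_eq, abs_lt]
        constructor <;> linarith [ht.1, ht.2]
      have h2 := h (hnear t ht)
      refine ⟨h2.1, fun t' ht' => ?_⟩
      have h3 := h (hnear t' ht')
      have h4 := dist_triangle_right (b t) (b t') (b t₀)
      have h5 := Metric.infDist_le_infDist_add_dist (s := A) (x := b t₀) (y := b t)
      rw [dist_comm] at h5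
      linarith [h2.2, h3.2])
  have hWO : ∀ J ∈ W, Set.Icc J.1 J.2 ⊆ O := fun J hJ t ht => ((hW J hJ).2 t ht).1
  have hWgood : ∀ J ∈ W, ∀ t ∈ Set.Icc J.1 J.2, b t ∉ A ∧ ∀ t' ∈ Set.Icc J.1 J.2,
      dist (b t) (b t') ≤ Metric.infDist (b t) A := fun J hJ t ht =>
    ⟨hbA t (hWO J hJ ht), ((hW J hJ).2 t ht).2⟩
  have hex : ∀ J : W, ∃ h, IsStripFilling A κ b J.1.1 J.1.2 h ∧ ∀ ε : ℝ,
      (∃ h', IsStripFilling A κ b J.1.1 J.1.2 h' ∧ ∀ z, Metric.infDist (h' z) A < ε / 2) →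
      ∀ z, Metric.infDist (h z) A < ε := by
    rintro ⟨J, hJ⟩
    have hmem : J.1 ∈ Set.Icc J.1 J.2 := ⟨le_rfl, (hW J hJ).1.le⟩
    have hJ1 := hWO J hJ hmem
    obtain ⟨h, ⟨_, h1, _⟩, h2⟩ := exists_near_optimal
      (fun (h : ℝ × I → X) (r : ℝ) => IsStripFilling A κ b J.1 J.2 h ∧
        ∀ z, Metric.infDist (h z) A < r) (hpos J.1 hJ1)
      (by
        rintro h r ⟨h1, h2⟩
        have h3 := h2 (J.1, 0)
        rw [h1.bottom _ hmem] at h3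
        exact h3.le)
      (by
        obtain ⟨h, h'⟩ := hδfill b J.1 J.2 (hW J hJ).1 (hb.mono (hWO J hJ)) (hWgood J hJ)
          ⟨J.1, hmem, hbδ _ hJ1⟩
        exact ⟨h, 1, h'⟩)
    refine ⟨h, h1, fun ε hε z => ?_⟩
    obtain ⟨r, hr, h3⟩ := h2 ε hε
    exact (h3.2 z).trans_le hr
  choose h hh hsmall using hex
  have hcov : ∀ t ∈ O, ∃ J : W, t ∈ Set.Icc J.1.1 J.1.2 := by
    intro t ht
    obtain ⟨J, hJ, -, -, h1, -⟩ := hWcov t ht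
    exact ⟨⟨J, hJ⟩, h1⟩
  -- Distinct intervals meet at most in an end point, where both fillings follow the path determined
  -- by `b t`.
  have hagree : ∀ J J' : W, ∀ t, t ∈ Set.Icc J.1.1 J.1.2 → t ∈ Set.Icc J'.1.1 J'.1.2 →
      ∀ s, h J (t, s) = h J' (t, s) := by
    intro J J' t ht ht' s
    rcases hWdisj J J.2 J' J'.2 with h1 | h1 | h1
    · rw [Subtype.ext h1]
    · have e1 : t = J.1.1 := le_antisymm (ht'.2.trans h1) ht.1
      have e2 : t = J'.1.2 := le_antisymm ht'.2 (h1.trans ht.1)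
      have h2 := (hh J).left s
      have h3 := (hh J').right s
      rw [← e1] at h2
      rw [← e2] at h3
      rw [h2, h3]
    · have e1 : t = J.1.2 := le_antisymm ht.2 (h1.trans ht'.1)
      have e2 : t = J'.1.1 := le_antisymm (ht.2.trans h1) ht'.1
      have h2 := (hh J).right s
      have h3 := (hh J').left s
      rw [← e1] at h2
      rw [← e2] at h3
      rw [h2, h3]
  let H : ℝ × I → X := fun z =>
    if hz : ∃ J : W, z.1 ∈ Set.Icc J.1.1 J.1.2 then h hz.choose z else b z.1
  have hH : ∀ (J : W) (t : ℝ) (s : I), t ∈ Set.Icc J.1.1 J.1.2 → H (t, s) = h J (t, s) := by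
    intro J t s ht
    have hz : ∃ J : W, t ∈ Set.Icc J.1.1 J.1.2 := ⟨J, ht⟩
    have : H (t, s) = h hz.choose (t, s) := dif_pos hz
    rw [this]
    exact hagree _ _ t hz.choose_spec ht s
  refine ⟨H, ?_, ?_, ?_, ?_⟩
  · rintro ⟨t, s⟩ ⟨ht, -⟩
    obtain ⟨J, hJ, J', hJ', h1, h2, h3⟩ := hWcov t ht
    have hc : ∀ J : W, t ∈ Set.Icc J.1.1 J.1.2 →
        ContinuousWithinAt H (Set.Icc J.1.1 J.1.2 ×ˢ Set.univ) (t, s) := by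
      intro J hJ
      refine (hh J).continuous.continuousWithinAt.congr ?_ (hH J t s hJ)
      rintro ⟨t', s'⟩ ⟨ht', -⟩
      exact hH J t' s' ht'
    have hu := (hc ⟨J, hJ⟩ h1).union (hc ⟨J', hJ'⟩ h2)
    rw [← Set.union_prod] at hu
    exact (hu.continuousAt (prod_mem_nhds h3 Filter.univ_mem)).continuousWithinAt
  · intro t ht
    obtain ⟨J, hJ⟩ := hcov t ht
    rw [hH J t 0 hJ, (hh J).bottom t hJ]
  · intro t ht
    obtain ⟨J, hJ⟩ := hcov t ht
    rw [hH J t 1 hJ]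
    exact (hh J).top t
  · intro t₀ ht₀ ε hε
    obtain ⟨δ', hδ', h'⟩ := hfill (ε / 2) (by linarith)
    filter_upwards [hlim t₀ ht₀ δ' hδ'] with t ht htO s
    obtain ⟨J, hJ⟩ := hcov t htO
    rw [hH J t s hJ]
    exact hsmall J ε (h' b J.1.1 J.1.2 (hW J J.2).1 (hb.mono (hWO J J.2)) (hWgood J J.2)
      ⟨t, hJ, ht htO⟩) _

/-! ### Lifting paths up to homotopy -/

/-- Opposite pairs of consecutive sides of a square are homotopic. -/
lemma Path.homotopic_of_square {Y : Type*} [TopologicalSpace Y] {a b c d : Y} (K : C(I × I, Y))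
    (B : Path a b) (T : Path c d) (L : Path a c) (R : Path b d) (hB : ∀ t, K (t, 0) = B t)
    (hT : ∀ t, K (t, 1) = T t) (hL : ∀ s, K (0, s) = L s) (hR : ∀ s, K (1, s) = R s) :
    (B.trans R).Homotopic (L.trans T) := by
  have : ContractibleSpace I := (convex_Icc (0 : ℝ) 1).contractibleSpace ⟨0, by simp⟩
  let B' : Path ((0, 0) : I × I) (1, 0) :=
    { toFun := fun t => (t, 0), source' := rfl, target' := rfl }
  let T' : Path ((0, 1) : I × I) (1, 1) :=
    { toFun := fun t => (t, 1), source' := rfl, target' := rfl }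
  let L' : Path ((0, 0) : I × I) (0, 1) :=
    { toFun := fun t => (0, t), source' := rfl, target' := rfl }
  let R' : Path ((1, 0) : I × I) (1, 1) :=
    { toFun := fun t => (1, t), source' := rfl, target' := rfl }
  obtain rfl : K (0, 0) = a := by rw [hB, B.source]
  obtain rfl : K (1, 0) = b := by rw [hB, B.target]
  obtain rfl : K (0, 1) = c := by rw [hT, T.source]
  obtain rfl : K (1, 1) = d := by rw [hT, T.target]
  have eB : B = B'.map K.continuous := by ext t; exact (hB t).symm
  have eT : T = T'.map K.continuous := by ext t; exact (hT t).symm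
  have eL : L = L'.map K.continuous := by ext t; exact (hL t).symm
  have eR : R = R'.map K.continuous := by ext t; exact (hR t).symm
  rw [eB, eT, eL, eR, ← Path.map_trans, ← Path.map_trans]
  exact (SimplyConnectedSpace.paths_homotopic (B'.trans R') (L'.trans T')).map K

/-- For any choice of points over the ends of `β`, the path `β` is homotopic to the image of a
path between these points. -/
def LiftsUpToHomotopy {X Y : Type*} [TopologicalSpace X] [TopologicalSpace Y] (f : C(X, Y))
    {y y' : Y} (β : Path y y') : Prop :=
  ∀ (x x' : X) (hx : f x = y) (hx' : f x' = y'),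
    ∃ ξ : Path x x', β.Homotopic ((ξ.map f.continuous).cast hx.symm hx'.symm)

namespace LiftsUpToHomotopy

variable {X Y : Type*} [TopologicalSpace X] [TopologicalSpace Y] {f : C(X, Y)}

lemma of_homotopic {y y' : Y} {β γ : Path y y'} (h : LiftsUpToHomotopy f β)
    (hβ : γ.Homotopic β) : LiftsUpToHomotopy f γ := fun x x' hx hx' => by
  obtain ⟨ξ, hξ⟩ := h x x' hx hx'
  exact ⟨ξ, hβ.trans hξ⟩

/-- Any point over `y₁` can end the first lift and start the second; this is why the definition
allows arbitrary points over the ends. -/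
lemma trans (hf : Function.Surjective f) {y₀ y₁ y₂ : Y} {β : Path y₀ y₁} {γ : Path y₁ y₂}
    (hβ : LiftsUpToHomotopy f β) (hγ : LiftsUpToHomotopy f γ) :
    LiftsUpToHomotopy f (β.trans γ) := by
  rintro x x' rfl rfl
  obtain ⟨z, rfl⟩ := hf y₁
  obtain ⟨ξ, hξ⟩ := hβ x z rfl rfl
  obtain ⟨ζ, hζ⟩ := hγ z x' rfl rfl
  refine ⟨ξ.trans ζ, ?_⟩
  rw [Path.map_trans]
  exact hξ.hcomp hζ

lemma of_cast {y y' z z' : Y} {β : Path y y'} {hz : z = y} {hz' : z' = y'}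
    (h : LiftsUpToHomotopy f (β.cast hz hz')) : LiftsUpToHomotopy f β := by
  subst hz hz'
  exact h

lemma of_locally (hf : Function.Surjective f)
    (h : ∀ y, ∃ W, IsOpen W ∧ y ∈ W ∧ ∀ (y₀ y₁ : Y) (β : Path y₀ y₁), (∀ t, β t ∈ W) →
      LiftsUpToHomotopy f β) {y y' : Y} (α : Path y y') : LiftsUpToHomotopy f α := by
  choose W hWo hyW hW using h
  obtain ⟨t, ht0, hmono, ⟨N, hN⟩, hsub⟩ := exists_monotone_Icc_subset_open_cover_unitInterval
    (c := fun y => α ⁻¹' W y) (fun y => (hWo y).preimage α.continuous)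
    (fun r _ => Set.mem_iUnion.2 ⟨α r, hyW _⟩)
  have key : ∀ n, LiftsUpToHomotopy f (α.subpath 0 (t n)) := by
    intro n
    induction n with
    | zero =>
      rw [ht0]
      refine hW (α 0) _ _ _ fun r => ?_
      rw [Path.subpath_self]
      exact hyW _
    | succ n ih =>
      obtain ⟨z, hz⟩ := hsub n
      have h1 : LiftsUpToHomotopy f (α.subpath (t n) (t (n + 1))) := by
        refine hW z _ _ _ fun r => ?_
        have h2 : α.subpath (t n) (t (n + 1)) r ∈ Set.range (α.subpath (t n) (t (n + 1))) :=
          ⟨r, rfl⟩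
        rw [Path.range_subpath_of_le _ _ _ (hmono n.le_succ)] at h2
        obtain ⟨r', hr', h3⟩ := h2
        rw [← h3]
        exact hz hr'
      exact (ih.trans hf h1).of_homotopic ⟨(Path.Homotopy.subpathTransSubpath α _ _ _).symm⟩
  have h1 := key N
  rw [hN N le_rfl, Path.subpath_zero_one] at h1
  exact h1.of_cast

end LiftsUpToHomotopy

/-! ### Topology of the quotient -/

namespace Collapse

variable {X ι : Type*} [TopologicalSpace X] {A : ι → Set X}

lemma mk_surjective : Function.Surjective (Collapse.mk A) := Quot.mk_surjective

lemma isOpen_iff {s : Set (Collapse A)} : IsOpen s ↔ IsOpen (Collapse.mk A ⁻¹' s) := Iff.rfl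

lemma mk_eq_of_mem {i : ι} {x y : X} (hx : x ∈ A i) (hy : y ∈ A i) :
    Collapse.mk A x = Collapse.mk A y := Quot.sound ⟨i, hx, hy⟩

/-- Disjointness makes "equal or in a common `A i`" transitive, so the generated equivalence
relation is no larger. -/
lemma eq_or_of_mk_eq (hdisj : Pairwise (fun i j => Disjoint (A i) (A j))) {x y : X}
    (h : Collapse.mk A x = Collapse.mk A y) : x = y ∨ ∃ i, x ∈ A i ∧ y ∈ A i := by
  have h' := Quot.eqvGen_exact h
  induction h' with
  | rel x y hxy => exact .inr hxy
  | refl x => exact .inl rfl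
  | symm x y _ ih =>
    rcases ih (Quot.eqvGen_sound ‹_›) with rfl | ⟨i, hx, hy⟩
    · exact .inl rfl
    · exact .inr ⟨i, hy, hx⟩
  | trans x y z _ _ ih₁ ih₂ =>
    rcases ih₁ (Quot.eqvGen_sound ‹_›) with rfl | ⟨i, hx, hy⟩
    · exact ih₂ (Quot.eqvGen_sound ‹_›)
    · rcases ih₂ (Quot.eqvGen_sound ‹_›) with rfl | ⟨j, hy', hz⟩
      · exact .inr ⟨i, hx, hy⟩
      · by_cases hij : i = j
        · subst hij
          exact .inr ⟨i, hx, hz⟩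
        · exact absurd hy' (Set.disjoint_left.1 (hdisj hij) hy)

lemma preimage_image (hdisj : Pairwise (fun i j => Disjoint (A i) (A j))) {U : Set X}
    (hU : ∀ i, A i ⊆ U ∨ Disjoint (A i) U) : Collapse.mk A ⁻¹' (Collapse.mk A '' U) = U := by
  refine Set.Subset.antisymm ?_ (Set.subset_preimage_image _ _)
  rintro x ⟨y, hy, hyx⟩
  rcases eq_or_of_mk_eq hdisj hyx with rfl | ⟨i, hyi, hxi⟩
  · exact hy
  · rcases hU i with h | h
    · exact h hxi
    · exact absurd hy (Set.disjoint_left.1 h hyi)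

lemma isOpen_image (hdisj : Pairwise (fun i j => Disjoint (A i) (A j))) {U : Set X}
    (hUo : IsOpen U) (hU : ∀ i, A i ⊆ U ∨ Disjoint (A i) U) : IsOpen (Collapse.mk A '' U) := by
  rw [isOpen_iff, preimage_image hdisj hU]
  exact hUo

/-- Away from the collapsed sets the inverse of the quotient map is continuous. -/
lemma continuousOn_section (hdisj : Pairwise (fun i j => Disjoint (A i) (A j)))
    (hcl : IsClosed (⋃ i, A i)) {s : Collapse A → X} (hs : ∀ y, Collapse.mk A (s y) = y) :
    ContinuousOn s (Collapse.mk A '' (⋃ i, A i)ᶜ) := by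
  rintro _ ⟨x, hx, rfl⟩
  have hsx : ∀ x, x ∉ ⋃ i, A i → s (Collapse.mk A x) = x := by
    intro x hx
    rcases eq_or_of_mk_eq hdisj (hs (Collapse.mk A x)) with h | ⟨i, -, h⟩
    · exact h
    · exact absurd (Set.mem_iUnion.2 ⟨i, h⟩) hx
  refine ContinuousAt.continuousWithinAt ?_
  intro N hN
  rw [hsx x hx] at hN
  obtain ⟨V, hVN, hVo, hxV⟩ := mem_nhds_iff.1 hN
  have h1 : IsOpen (Collapse.mk A '' (V ∩ (⋃ i, A i)ᶜ)) :=
    isOpen_image hdisj (hVo.inter hcl.isOpen_compl) fun i => .inr <|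
      Set.disjoint_left.2 fun z hz hz' => hz'.2 (Set.mem_iUnion.2 ⟨i, hz⟩)
  rw [Filter.mem_map]
  refine Filter.mem_of_superset (h1.mem_nhds ⟨x, ⟨hxV, hx⟩, rfl⟩) ?_
  rintro _ ⟨z, hz, rfl⟩
  rw [Set.mem_preimage, hsx z hz.2]
  exact hVN hz.1

/-- Paths which avoid the collapsed sets lift. -/
lemma liftsUpToHomotopy_of_compl (hdisj : Pairwise (fun i j => Disjoint (A i) (A j)))
    (hcl : IsClosed (⋃ i, A i)) {y₀ y₁ : Collapse A} (β : Path y₀ y₁)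
    (hβ : ∀ t, β t ∈ Collapse.mk A '' (⋃ i, A i)ᶜ) :
    LiftsUpToHomotopy (Collapse.mk A) β := by
  rintro x x' rfl rfl
  obtain ⟨s, hs⟩ := (mk_surjective (A := A)).hasRightInverse
  have hend : ∀ z, Collapse.mk A z ∈ Collapse.mk A '' (⋃ i, A i)ᶜ → s (Collapse.mk A z) = z := by
    rintro z ⟨w, hw, hwz⟩
    rw [← hwz]
    have hu : ∀ z', Collapse.mk A w = Collapse.mk A z' → w = z' := by
      intro z' h
      rcases eq_or_of_mk_eq hdisj h with h | ⟨i, h, -⟩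
      · exact h
      · exact absurd (Set.mem_iUnion.2 ⟨i, h⟩) hw
    rw [← hu _ (hs (Collapse.mk A w)).symm, hu z hwz]
  have h0 := hβ 0
  have h1 := hβ 1
  rw [β.source] at h0
  rw [β.target] at h1
  let ξ : Path x x' :=
    { toFun := fun t => s (β t)
      continuous_toFun := (continuousOn_section hdisj hcl hs).comp_continuous β.continuous hβ
      source' := by rw [β.source, hend x h0]
      target' := by rw [β.target, hend x' h1] }
  refine ⟨ξ, ?_⟩
  have : β = (ξ.map (Collapse.mk A).continuous).cast rfl rfl := by
    ext t
    exact (hs (β t)).symm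
  rw [← this]

end Collapse

/-! ### Paths near a collapsed point -/

namespace Collapse

/-- Paths which stay near one of the collapsed sets lift up to homotopy. -/
lemma exists_isOpen_liftsUpToHomotopy {X ι : Type*} [MetricSpace X] [Finite ι]
    (hX : LocallyOneConnected X) {A : ι → Set X}
    (hdisj : Pairwise (fun i j => Disjoint (A i) (A j))) (hcomp : ∀ i, IsCompact (A i)) (i : ι)
    (hconn : IsConnected (A i)) (hlpc : LocallyPathConnectedSpace (A i)) :
    ∃ W : Set (Collapse A), IsOpen W ∧ (∀ x ∈ A i, Collapse.mk A x ∈ W) ∧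
      ∀ (y₀ y₁ : Collapse A) (β : Path y₀ y₁), (∀ t, β t ∈ W) →
        LiftsUpToHomotopy (Collapse.mk A) β := by
  classical
  obtain ⟨a, ha⟩ := hconn.nonempty
  have hne : (A i).Nonempty := ⟨a, ha⟩
  have hcl : IsClosed (⋃ j, A j) := isClosed_iUnion_of_finite fun j => (hcomp j).isClosed
  have hcl' : IsClosed (⋃ j : {j // j ≠ i}, A j) :=
    isClosed_iUnion_of_finite fun j => (hcomp j).isClosed
  -- `δ₁` keeps the neighbourhood away from the other collapsed sets; `δ₂` below is the range in
  -- which the push into `A i` works.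
  obtain ⟨δ₁, hδ₁, hthick⟩ := (hcomp i).exists_thickening_subset_open hcl'.isOpen_compl (by
    intro x hx hx'
    obtain ⟨j, hj⟩ := Set.mem_iUnion.1 hx'
    exact Set.disjoint_left.1 (hdisj j.2) hj hx)
  obtain ⟨δ₂, hδ₂, hcore⟩ := exists_homotopy_into hX (hcomp i) hne hlpc
  set δ := min δ₁ δ₂ with hδdef
  have hδ : 0 < δ := lt_min hδ₁ hδ₂
  have hdis : ∀ j, j ≠ i → ∀ r ≤ δ, Disjoint (A j) (Metric.thickening r (A i)) := by
    intro j hj r hr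
    refine Set.disjoint_left.2 fun x hx hx' => ?_
    exact hthick (Metric.thickening_mono (hr.trans (min_le_left _ _)) _ hx')
      (Set.mem_iUnion.2 ⟨⟨j, hj⟩, hx⟩)
  have hsat : ∀ r, 0 < r → r ≤ δ → ∀ j, A j ⊆ Metric.thickening r (A i) ∨
      Disjoint (A j) (Metric.thickening r (A i)) := by
    intro r hr hrδ j
    by_cases hj : j = i
    · subst hj
      exact .inl (Metric.self_subset_thickening hr _)
    · exact .inr (hdis j hj r hrδ)
  have hWo : ∀ r, 0 < r → r ≤ δ → IsOpen (Collapse.mk A '' Metric.thickening r (A i)) :=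
    fun r hr hrδ => isOpen_image hdisj Metric.isOpen_thickening (hsat r hr hrδ)
  refine ⟨Collapse.mk A '' Metric.thickening δ (A i), hWo δ hδ le_rfl,
    fun x hx => ⟨x, Metric.self_subset_thickening hδ _ hx, rfl⟩, ?_⟩
  rintro _ _ β hβ x x' rfl rfl
  obtain ⟨s, hs⟩ := (mk_surjective (A := A)).hasRightInverse
  set y : Collapse A := Collapse.mk A a with hy
  have hyA : ∀ z, Collapse.mk A z = y ↔ z ∈ A i := by
    intro z
    refine ⟨fun h => ?_, fun h => mk_eq_of_mem h ha⟩
    rcases eq_or_of_mk_eq hdisj h with rfl | ⟨j, hz, haj⟩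
    · exact ha
    · by_cases hj : j = i
      · exact hj ▸ hz
      · exact absurd ha (Set.disjoint_left.1 (hdisj hj) haj)
  have hinj : ∀ z ∈ Metric.thickening δ (A i), Collapse.mk A z ≠ y →
      s (Collapse.mk A z) = z ∧ z ∉ ⋃ j, A j := by
    intro z hz hzy
    have hzA : z ∉ ⋃ j, A j := by
      intro h
      obtain ⟨j, hj⟩ := Set.mem_iUnion.1 h
      by_cases hji : j = i
      · subst hji
        exact hzy ((hyA z).2 hj)
      · exact Set.disjoint_left.1 (hdis j hji δ le_rfl) hj hz
    refine ⟨?_, hzA⟩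
    rcases eq_or_of_mk_eq hdisj (hs (Collapse.mk A z)) with h | ⟨j, -, h⟩
    · exact h
    · exact absurd (Set.mem_iUnion.2 ⟨j, h⟩) hzA
  have hβe : ∀ t : ℝ, β.extend t ∈ Collapse.mk A '' Metric.thickening δ (A i) := fun t => hβ _
  have hyc : IsClosed ({y} : Set (Collapse A)) := by
    rw [← isOpen_compl_iff, isOpen_iff]
    have : Collapse.mk A ⁻¹' {y}ᶜ = (A i)ᶜ := by
      ext z
      simp [hyA]
    rw [this]
    exact (hcomp i).isClosed.isOpen_compl
  set O : Set ℝ := {t | β.extend t ≠ y} with hO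
  have hOo : IsOpen O := hyc.isOpen_compl.preimage β.continuous_extend
  have hOmem : ∀ t ∈ O, β.extend t ∈ Collapse.mk A '' (⋃ j, A j)ᶜ := by
    intro t ht
    obtain ⟨z, hz, hzt⟩ := hβe t
    exact ⟨z, (hinj z hz (by rw [hzt]; exact ht)).2, hzt⟩
  have hbthick : ∀ t ∈ O, ∀ r ≤ δ, β.extend t ∈ Collapse.mk A '' Metric.thickening r (A i) →
      Metric.infDist (s (β.extend t)) (A i) < r := by
    rintro t ht r hr ⟨z, hz, hzt⟩
    have h1 := (hinj z (Metric.thickening_mono hr _ hz) (by rw [hzt]; exact ht)).1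
    rw [← hzt, h1]
    obtain ⟨w, hw, hzw⟩ := Metric.mem_thickening_iff.1 hz
    exact (Metric.infDist_le_dist_of_mem hw).trans_lt hzw
  obtain ⟨H, hHc, hH0, hH1, hHlim⟩ := hcore O (fun t => s (β.extend t)) hOo
    ((continuousOn_section hdisj hcl hs).comp β.continuous_extend.continuousOn hOmem)
    (fun t ht h => ht (by rw [← hs (β.extend t)]; exact (hyA _).2 h))
    (fun t ht => (hbthick t ht δ le_rfl (hβe t)).trans_le (min_le_right _ _))
    (by
      intro t₀ ht₀ ε hε
      have h0 : β.extend t₀ = y := not_not.1 ht₀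
      have hr : 0 < min ε δ := lt_min hε hδ
      have h1 : Collapse.mk A '' Metric.thickening (min ε δ) (A i) ∈ 𝓝 (β.extend t₀) :=
        (hWo _ hr (min_le_right _ _)).mem_nhds
          (by rw [h0]; exact ⟨a, Metric.self_subset_thickening hr _ ha, rfl⟩)
      filter_upwards [β.continuous_extend.continuousAt.eventually_mem h1] with t ht htO
      exact (hbthick t htO _ (min_le_right _ _) ht).trans_le (min_le_left _ _))
  let K' : ℝ × I → Collapse A := fun z => if z.1 ∈ O then Collapse.mk A (H z) else y
  have hK'c : Continuous K' := by
    rw [continuous_iff_continuousAt]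
    rintro ⟨t₀, s₀⟩
    by_cases ht₀ : t₀ ∈ O
    · have hnhds : O ×ˢ Set.univ ∈ 𝓝 (t₀, s₀) := prod_mem_nhds (hOo.mem_nhds ht₀) Filter.univ_mem
      have h1 : ContinuousAt (fun z => Collapse.mk A (H z)) (t₀, s₀) :=
        (Collapse.mk A).continuous.continuousAt.comp (hHc.continuousAt hnhds)
      refine h1.congr ?_
      filter_upwards [hnhds] with z hz
      exact (if_pos hz.1).symm
    · have h1 : K' (t₀, s₀) = y := if_neg ht₀
      rw [ContinuousAt, h1]
      intro N hN
      obtain ⟨V, hVN, hVo, hyV⟩ := mem_nhds_iff.1 hN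
      -- By compactness the preimage of a neighbourhood of `y` contains a metric thickening of `A
      -- i`, so distance to `A i` controls convergence to `y`.
      obtain ⟨ε, hε, hεV⟩ := (hcomp i).exists_thickening_subset_open (isOpen_iff.1 hVo)
        (fun z hz => by rw [Set.mem_preimage, (hyA z).2 hz]; exact hyV)
      have h2 : ∀ᶠ z : ℝ × I in 𝓝 (t₀, s₀), z.1 ∈ O →
          ∀ s, Metric.infDist (H (z.1, s)) (A i) < ε :=
        (continuous_fst.tendsto (t₀, s₀)).eventually (hHlim t₀ ht₀ ε hε)
      rw [Filter.mem_map]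
      filter_upwards [h2] with z hz
      by_cases hzO : z.1 ∈ O
      · have h3 : K' z = Collapse.mk A (H z) := if_pos hzO
        rw [Set.mem_preimage, h3]
        obtain ⟨w, hw, hzw⟩ := (Metric.infDist_lt_iff hne).1 (hz hzO z.2)
        exact hVN (hεV (Metric.mem_thickening_iff.2 ⟨w, hw, hzw⟩))
      · have h3 : K' z = y := if_neg hzO
        rw [Set.mem_preimage, h3]
        exact hVN hyV
  let K : C(I × I, Collapse A) := ⟨fun z => K' (z.1, z.2), by fun_prop⟩
  have hbot : ∀ t, K (t, 0) = β t := by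
    intro t
    have h1 : β.extend (t : ℝ) = β t := Path.extend_apply β t.2
    by_cases ht : (t : ℝ) ∈ O
    · refine (if_pos ht).trans ?_
      rw [hH0 t ht, hs, h1]
    · refine (if_neg ht).trans ?_
      rw [← h1]
      exact (not_not.1 ht).symm
  have htop : ∀ t, K (t, 1) = y := by
    intro t
    by_cases ht : (t : ℝ) ∈ O
    · exact (if_pos ht).trans ((hyA _).2 (hH1 t ht))
    · exact if_neg ht
  -- The vertical side over `t` lifts to `H (t, ·)` when `t ∈ O`; otherwise it is constant and `z`
  -- already lies in `A i`.
  have hside : ∀ (t : I) (z : X), Collapse.mk A z = β t → ∃ e ∈ A i, ∃ ζ : Path z e,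
      ∀ r, K (t, r) = Collapse.mk A (ζ r) := by
    intro t z hz
    have h1 : β.extend (t : ℝ) = β t := Path.extend_apply β t.2
    by_cases ht : (t : ℝ) ∈ O
    · have hzs : H ((t : ℝ), 0) = z := by
        rw [hH0 t ht]
        obtain ⟨w, hw, hwt⟩ := hβe t
        have h2 := hinj w hw (by rw [hwt]; exact ht)
        rw [← hwt, h2.1]
        rcases eq_or_of_mk_eq hdisj (hwt.trans (h1.trans hz.symm)) with h | ⟨j, h, -⟩
        · exact h
        · exact absurd (Set.mem_iUnion.2 ⟨j, h⟩) h2.2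
      refine ⟨H ((t : ℝ), 1), hH1 t ht,
        { toFun := fun r => H ((t : ℝ), r)
          continuous_toFun := hHc.comp_continuous (by fun_prop) fun r => ⟨ht, trivial⟩
          source' := hzs
          target' := rfl }, fun r => if_pos ht⟩
    · refine ⟨z, (hyA z).1 (by rw [hz, ← h1]; exact not_not.1 ht), Path.refl z, fun r => ?_⟩
      refine (if_neg ht).trans ?_
      rw [Path.refl_apply, hz, ← h1]
      exact (not_not.1 ht).symm
  obtain ⟨e₀, he₀, ζ₀, hζ₀⟩ := hside 0 x β.source.symm
  obtain ⟨e₁, he₁, ζ₁, hζ₁⟩ := hside 1 x' β.target.symm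
  have : ConnectedSpace (A i) := isConnected_iff_connectedSpace.1 hconn
  have : PathConnectedSpace (A i) := pathConnectedSpace_iff_connectedSpace.2 this
  let τ : Path e₀ e₁ :=
    (PathConnectedSpace.somePath (⟨e₀, he₀⟩ : A i) ⟨e₁, he₁⟩).map continuous_subtype_val
  have hτ : ∀ t, Collapse.mk A (τ t) = y := fun t => (hyA _).2
    ((PathConnectedSpace.somePath (⟨e₀, he₀⟩ : A i) ⟨e₁, he₁⟩) t).2
  have hsq := Path.homotopic_of_square K β (τ.map (Collapse.mk A).continuous)
    (ζ₀.map (Collapse.mk A).continuous) (ζ₁.map (Collapse.mk A).continuous) hbot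
    (fun t => (htop t).trans (hτ t).symm) hζ₀ hζ₁
  refine ⟨(ζ₀.trans τ).trans ζ₁.symm, ?_⟩
  change β.Homotopic (((ζ₀.trans τ).trans ζ₁.symm).map (Collapse.mk A).continuous)
  rw [Path.map_trans, Path.map_trans, ← Path.map_symm]
  rw [← Path.Homotopic.Quotient.eq] at hsq ⊢
  have h2 := congrArg (fun q => q.trans
    (Path.Homotopic.Quotient.mk (ζ₁.map (Collapse.mk A).continuous)).symm) hsq
  simpa [Path.Homotopic.Quotient.mk_trans, Path.Homotopic.Quotient.trans_assoc,
    Path.Homotopic.Quotient.mk_symm, -Path.map_symm] using h2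

end Collapse

theorem theoremB {X : Type*} [MetricSpace X] (hX : LocallyOneConnected X)
    {n : ℕ} (A : Fin n → Set X)
    (hdisj : Pairwise (fun i j => Disjoint (A i) (A j)))
    (hconn : ∀ i, IsConnected (A i))
    (hlpc : ∀ i, LocallyPathConnectedSpace (A i))
    (hcomp : ∀ i, IsCompact (A i))
    (a : X) (ha : a ∈ ⋃ i, A i) :
    Function.Surjective
      (QTopFundamentalGroup.map (Collapse.mk A) a :
        QTopFundamentalGroup X a →ₜ* QTopFundamentalGroup (Collapse A) (Collapse.mk A a)) := by
  have hcl : IsClosed (⋃ j, A j) := isClosed_iUnion_of_finite fun j => (hcomp j).isClosed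
  intro g
  obtain ⟨α, hα⟩ : ∃ α : Path (Collapse.mk A a) (Collapse.mk A a),
      QTopFundamentalGroup.mk α = g := Path.Homotopic.Quotient.mk_surjective g
  have hlift : LiftsUpToHomotopy (Collapse.mk A) α := by
    refine LiftsUpToHomotopy.of_locally Collapse.mk_surjective (fun y => ?_) α
    obtain ⟨x, rfl⟩ := Collapse.mk_surjective y
    by_cases hx : x ∈ ⋃ i, A i
    · obtain ⟨i, hi⟩ := Set.mem_iUnion.1 hx
      obtain ⟨W, hWo, hW, h⟩ := Collapse.exists_isOpen_liftsUpToHomotopy hX hdisj hcomp i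
        (hconn i) (hlpc i)
      exact ⟨W, hWo, hW x hi, h⟩
    · exact ⟨_, Collapse.isOpen_image hdisj hcl.isOpen_compl
        (fun i => .inr (Set.disjoint_left.2 fun z hz hz' => hz' (Set.mem_iUnion.2 ⟨i, hz⟩))),
        ⟨x, hx, rfl⟩, fun _ _ β hβ => Collapse.liftsUpToHomotopy_of_compl hdisj hcl β hβ⟩
  obtain ⟨ξ, hξ⟩ := hlift a a rfl rfl
  refine ⟨QTopFundamentalGroup.mk ξ, ?_⟩
  rw [QTopFundamentalGroup.map_mk, ← hα]
  exact (Path.Homotopic.Quotient.eq.2 hξ).symm
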